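/- Let $K$ be a field of characteristic zero, $n\in\mathbb{N}$, $P_n=K[x_1,\dots,x_n]$ and $G_n={\rm Aut}_{K\text{-alg}}(P_n)$. For a $K$-derivation $\partial=\sum_{i=1}^n a_i\frac{\partial}{\partial x_i}$ of $P_n$ (with $a_i=\partial(x_i)$) let ${\rm div}(\partial)=\sum_{i=1}^n\frac{\partial a_i}{\partial x_i}$, and let $\mathfrak{div}_n^c=\{\partial\in{\rm Der}_K(P_n) : {\rm div}(\partial)\in K\}$, a Lie algebra over $K$ under the commutator bracket. Then for every $\sigma\in G_n$ and $\partial\in\mathfrak{div}_n^c$ one has $\sigma\partial\sigma^{-1}\in\mathfrak{div}_n^c$, and the map $$G_n\longrightarrow {\rm Aut}_{\rm Lie}(\mathfrak{div}_n^c),\qquad \sigma\longmapsto(\partial\mapsto\sigma\partial\sigma^{-1}),$$ is an isomorphism of groups, where ${\rm Aut}_{\rm Lie}(\mathfrak{div}_n^c)$ is the group of $K$-linear Lie algebra automorphisms of $\mathfrak{div}_n^c$. In particular, every Lie algebra automorphism of $\mathfrak{div}_n^c$ is induced by a unique polynomial automorphism $\sigma\in G_n$. -/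

import Mathlib

noncomputable section

namespace PolyVectorField

/-- The Lie algebra automorphisms of `L` form a group under composition,
`(e * f) x = e (f x)`. -/
instance lieAutGroup (K L : Type*) [CommRing K] [LieRing L] [LieAlgebra K L] :
    Group (L ≃ₗ⁅K⁆ L) where
  mul e f := f.trans e
  one := 1
  inv e := e.symm
  mul_assoc _ _ _ := rfl
  one_mul _ := rfl
  mul_one _ := rfl
  inv_mul_cancel e := LieEquiv.ext fun x => e.symm_apply_apply x

/-- `P_n = K[x_1, …, x_n]`. -/
abbrev P (K : Type*) [Field K] (n : ℕ) : Type _ := MvPolynomial (Fin n) K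

/-- `D_n = Der_K(P_n)`, the Lie algebra of polynomial vector fields. -/
abbrev D (K : Type*) [Field K] (n : ℕ) : Type _ := Derivation K (P K n) (P K n)

/-- The divergence of `∂ = ∑ a_i ∂/∂x_i`, where `a_i = ∂(x_i)`, is `∑ ∂a_i/∂x_i`. -/
def divergence {K : Type*} [Field K] {n : ℕ} (d : D K n) : P K n :=
  ∑ i : Fin n, MvPolynomial.pderiv i (d (MvPolynomial.X i))

theorem divergence_zero {K : Type*} [Field K] {n : ℕ} :
    divergence (0 : D K n) = 0 := by
  simp [divergence]

theorem divergence_add {K : Type*} [Field K] {n : ℕ} (d e : D K n) :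
    divergence (d + e) = divergence d + divergence e := by
  simp [divergence, Finset.sum_add_distrib]

theorem divergence_smul {K : Type*} [Field K] {n : ℕ} (c : K) (d : D K n) :
    divergence (c • d) = c • divergence d := by
  simp [divergence, Finset.smul_sum]

theorem sum_apply {K : Type*} [Field K] {n : ℕ} (f : Fin n → D K n) (p : P K n) :
    (∑ i : Fin n, f i) p = ∑ i : Fin n, f i p := by
  have h := map_sum (Derivation.coeFnAddMonoidHom : D K n →+ (P K n → P K n)) f Finset.univ
  have h' := congrFun h p
  rw [Finset.sum_apply] at h'
  exact h'

/-- A derivation of `P_n` is the sum of its coordinates times the partial derivatives. -/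
theorem apply_eq_sum {K : Type*} [Field K] {n : ℕ} (d : D K n) (p : P K n) :
    d p = ∑ i : Fin n, d (MvPolynomial.X i) * MvPolynomial.pderiv i p := by
  classical
  have h : d = ∑ i : Fin n, d (MvPolynomial.X i) •
      (MvPolynomial.pderiv i : Derivation K (P K n) (P K n)) := by
    refine MvPolynomial.derivation_ext fun j => ?_
    rw [sum_apply]
    simp [MvPolynomial.pderiv_X, Pi.single_apply]
  conv_lhs => rw [h]
  rw [sum_apply]
  simp

theorem pderiv_comm {K : Type*} [Field K] {n : ℕ} (i j : Fin n) (p : P K n) :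
    MvPolynomial.pderiv i (MvPolynomial.pderiv j p) =
      MvPolynomial.pderiv j (MvPolynomial.pderiv i p) := by
  classical
  have h : ⁅(MvPolynomial.pderiv i : D K n), (MvPolynomial.pderiv j : D K n)⁆ = 0 := by
    refine MvPolynomial.derivation_ext fun k => ?_
    simp only [Derivation.commutator_apply, MvPolynomial.pderiv_X, Pi.single_apply]
    split_ifs <;> simp
  have h' := DFunLike.congr_fun h p
  rw [Derivation.commutator_apply] at h'
  exact sub_eq_zero.mp h'

theorem divergence_lie {K : Type*} [Field K] {n : ℕ} (d e : D K n) :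
    divergence ⁅d, e⁆ = d (divergence e) - e (divergence d) := by
  have key : ∀ d e : D K n, ∑ i : Fin n, MvPolynomial.pderiv i (d (e (MvPolynomial.X i))) =
      (∑ i : Fin n, ∑ j : Fin n, MvPolynomial.pderiv i (d (MvPolynomial.X j)) *
        MvPolynomial.pderiv j (e (MvPolynomial.X i))) + d (divergence e) := by
    intro d e
    rw [divergence, map_sum, ← Finset.sum_add_distrib]
    refine Finset.sum_congr rfl fun i _ => ?_
    rw [apply_eq_sum d (e (MvPolynomial.X i)),
      apply_eq_sum d (MvPolynomial.pderiv i (e (MvPolynomial.X i))), map_sum,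
      ← Finset.sum_add_distrib]
    refine Finset.sum_congr rfl fun j _ => ?_
    rw [MvPolynomial.pderiv_mul, pderiv_comm i j]
  have h1 := key d e
  have h2 := key e d
  rw [Finset.sum_comm] at h2
  have h3 : divergence ⁅d, e⁆ =
      ∑ i : Fin n, MvPolynomial.pderiv i (d (e (MvPolynomial.X i))) -
      ∑ i : Fin n, MvPolynomial.pderiv i (e (d (MvPolynomial.X i))) := by
    simp [divergence, Derivation.commutator_apply, Finset.sum_sub_distrib]
  rw [h3, h1, h2]
  have h4 : ∑ y : Fin n, ∑ x : Fin n, MvPolynomial.pderiv x (e (MvPolynomial.X y)) *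
        MvPolynomial.pderiv y (d (MvPolynomial.X x)) =
      ∑ i : Fin n, ∑ j : Fin n, MvPolynomial.pderiv i (d (MvPolynomial.X j)) *
        MvPolynomial.pderiv j (e (MvPolynomial.X i)) :=
    Finset.sum_congr rfl fun i _ => Finset.sum_congr rfl fun j _ => mul_comm _ _
  rw [h4]
  ring

/-- `div_n^c`, the Lie algebra of polynomial vector fields whose divergence lies in `K`. -/
def divC (K : Type*) [Field K] (n : ℕ) : LieSubalgebra K (D K n) where
  carrier := {d | ∃ c : K, divergence d = MvPolynomial.C c}
  zero_mem' := ⟨0, by simp [divergence_zero]⟩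
  add_mem' := by
    rintro d e ⟨a, ha⟩ ⟨b, hb⟩
    exact ⟨a + b, by rw [divergence_add, ha, hb, map_add]⟩
  smul_mem' := by
    rintro c d ⟨a, ha⟩
    exact ⟨c * a, by rw [divergence_smul, ha, MvPolynomial.smul_eq_C_mul, map_mul]⟩
  lie_mem' := by
    rintro d e ⟨a, ha⟩ ⟨b, hb⟩
    exact ⟨0, by rw [divergence_lie, ha, hb]; simp⟩

end PolyVectorField

end

noncomputable section

namespace PolyVectorField

open MvPolynomial

variable {K : Type*} [Field K] {n : ℕ}

/-! Conjugation by `σ` sends `div ∂` to `σ (div ∂)`: the fields `σ ∂_i σ⁻¹` commute and have a unit,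
hence constant, coefficient determinant, so each has divergence zero.

Conversely, for a Lie automorphism `φ`, the fields `frame φ i = φ(∂_i)` commute, have divergence
zero and act ad-nilpotently on `div_n^c`. Their common kernel is `K`: if all of them kill `f`, then
multiplication by `f` preserves their finite-dimensional span, so `f` is integral over `K`. They are
independent over `P_n`: a shortest relation yields quotients killed by the whole frame, and such
quotients are constant (`ratio_const_of_frame`). So their determinant is nonzero; being killed by
the frame, it is constant, and the frame is a `P_n`-basis of `Der P_n`.

Expanding the image of the Euler field as `∑ x_j φ(∂_j)` gives coordinates with `φ(∂_k)(x_j) =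
δ_kj`. The substitution `X_j ↦ x_j` intertwines each `z` with `φ z`; it is injective because a
nonzero kernel would contain a nonzero constant, and surjective because its image is a nonconstant
subalgebra stable under `div_n^c`. -/

theorem totalDegree_pderiv_le (i : Fin n) (p : P K n) :
    (pderiv i p).totalDegree ≤ p.totalDegree - 1 := by
  classical
  refine Finset.sup_le fun m hm => ?_
  rw [mem_support_iff, coeff_pderiv] at hm
  have h := le_totalDegree (mem_support_iff.2 (left_ne_zero_of_mul hm))
  rw [Finsupp.sum_add_index' (fun _ => rfl) (fun _ _ _ => rfl), Finsupp.sum_single_index rfl] at h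
  omega

theorem eq_C_of_pderiv_eq_zero [CharZero K] {p : P K n} (h : ∀ i, pderiv i p = 0) :
    ∃ c : K, p = C c := by
  classical
  refine ⟨coeff 0 p, ?_⟩
  ext m
  rw [coeff_C]
  split_ifs with hm
  · rw [hm]
  · obtain ⟨i, hi⟩ : ∃ i, m i ≠ 0 := by
      by_contra! hc
      exact hm (Finsupp.ext fun i => (hc i).symm)
    have h1 := congrArg (coeff (m - Finsupp.single i 1)) (h i)
    have h2 : m - Finsupp.single i 1 + Finsupp.single i 1 = m :=
      tsub_add_cancel_of_le (Finsupp.single_le_iff.2 (Nat.one_le_iff_ne_zero.2 hi))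
    rw [coeff_pderiv, h2, coeff_zero] at h1
    exact (mul_eq_zero.1 h1).resolve_right (Nat.cast_add_one_ne_zero _)

theorem pderiv_iterate_totalDegree (i : Fin n) :
    ∀ (m : ℕ) (p : P K n), p.totalDegree < m → (pderiv i)^[m] p = 0 := by
  intro m
  induction m with
  | zero => intro p hp; omega
  | succ m ih =>
    intro p hp
    rw [Function.iterate_succ_apply]
    by_cases h0 : p.totalDegree = 0
    · rw [totalDegree_eq_zero_iff_eq_C.1 h0, pderiv_C, iterate_map_zero]
    · exact ih _ (by have := totalDegree_pderiv_le i p; omega)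

theorem pderiv_locally_nilpotent (i : Fin n) (p : P K n) : ∃ m, (pderiv i)^[m] p = 0 :=
  ⟨_, pderiv_iterate_totalDegree i _ p (Nat.lt_succ_self _)⟩

/-! ### Commuting locally nilpotent operators -/

/-- A nonzero subspace stable under commuting locally nilpotent operators contains a nonzero
common kernel vector. -/
theorem exists_common_kernel {ι V : Type*} [AddCommGroup V] [Module K V] (T : ι → V →ₗ[K] V)
    (comm : ∀ i j v, T i (T j v) = T j (T i v)) (nil : ∀ i v, ∃ m, (T i)^[m] v = 0)
    (S : Submodule K V) (stab : ∀ i, ∀ v ∈ S, T i v ∈ S) {v : V} (hv : v ∈ S) (hv0 : v ≠ 0)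
    (s : Finset ι) : ∃ w ∈ S, w ≠ 0 ∧ ∀ i ∈ s, T i w = 0 := by
  classical
  induction s using Finset.induction_on with
  | empty => exact ⟨v, hv, hv0, by simp⟩
  | insert a s _ ih =>
    obtain ⟨w, hw, hw0, hs⟩ := ih
    have hfind := Nat.find_spec (nil a w)
    obtain ⟨k, hk⟩ : ∃ k, Nat.find (nil a w) = k + 1 := by
      refine Nat.exists_eq_succ_of_ne_zero fun h0 => hw0 ?_
      rw [h0] at hfind
      exact hfind
    have hiter : ∀ m, (T a)^[m] w ∈ S ∧ ∀ i ∈ s, T i ((T a)^[m] w) = 0 := by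
      intro m
      induction m with
      | zero => exact ⟨hw, hs⟩
      | succ m ihm =>
        rw [Function.iterate_succ_apply']
        exact ⟨stab a _ ihm.1, fun i hi => by rw [comm, ihm.2 i hi, map_zero]⟩
    refine ⟨(T a)^[k] w, (hiter k).1, Nat.find_min (nil a w) (by omega), ?_⟩
    intro i hi
    rcases Finset.mem_insert.1 hi with rfl | hi
    · rw [hk, Function.iterate_succ_apply'] at hfind
      exact hfind
    · exact (hiter k).2 i hi

/-- A quotient `a / b` annihilated by a commuting family of locally nilpotent derivations whose
common kernel is `K` lies in `K`. -/
theorem eq_C_mul_of_wronskian_eq_zero (d : Fin n → D K n)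
    (comm : ∀ i j p, d i (d j p) = d j (d i p)) (nil : ∀ i p, ∃ m, (d i)^[m] p = 0)
    (ker : ∀ p, (∀ i, d i p = 0) → ∃ c : K, p = C c) {a b : P K n} (hb : b ≠ 0)
    (h : ∀ i, b * d i a = a * d i b) : ∃ c : K, a = C c * b := by
  -- `S` is the ideal of denominators of `a / b`. It contains `b` and is stable under the `d i`, so
  -- it contains a nonzero constant; the corresponding numerator is then killed by every `d i`.
  let S : Submodule K (P K n) :=
    { carrier := {c | ∃ q, c * a = b * q}
      zero_mem' := ⟨0, by simp⟩
      add_mem' := by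
        rintro x y ⟨p, hp⟩ ⟨q, hq⟩
        exact ⟨p + q, by rw [add_mul, hp, hq, mul_add]⟩
      smul_mem' := by
        rintro c x ⟨p, hp⟩
        exact ⟨c • p, by rw [smul_mul_assoc, hp, mul_smul_comm]⟩ }
  have key : ∀ i c q, c * a = b * q → d i c * a = b * d i q := by
    intro i c q hq
    have h1 := congrArg (d i) hq
    simp only [Derivation.leibniz, smul_eq_mul] at h1
    refine mul_left_cancel₀ hb ?_
    linear_combination b * h1 - c * h i - d i b * hq
  obtain ⟨w, ⟨q, hq⟩, hw0, hw⟩ := exists_common_kernel (fun i => (d i : P K n →ₗ[K] P K n))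
    comm nil S (by rintro i c ⟨q, hq⟩; exact ⟨d i q, key i c q hq⟩) (v := b) ⟨a, rfl⟩ hb
    Finset.univ
  obtain ⟨c, rfl⟩ := ker w fun i => hw i (Finset.mem_univ i)
  have hc : c ≠ 0 := fun h => hw0 (by rw [h, C_0])
  obtain ⟨e, rfl⟩ := ker q fun i => by
    have := key i _ _ hq
    rw [show d i (C c) = 0 from hw i (Finset.mem_univ i), zero_mul] at this
    exact (mul_eq_zero.1 this.symm).resolve_left hb
  refine ⟨c⁻¹ * e, ?_⟩
  have : C c⁻¹ * (C c * a) = C c⁻¹ * (b * C e) := by rw [hq]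
  rw [← mul_assoc, ← C_mul, inv_mul_cancel₀ hc, C_1, one_mul] at this
  rw [this, C_mul]
  ring

/-! ### Nilpotency subalgebras and subalgebras stable under `div_n^c` -/

/-- By the Leibniz rule each application of `T` lowers one of the two nilpotency indices. It serves
both for products of polynomials and for a field evaluated on a polynomial. -/
theorem iterate_pairing {A B V : Type*} [Zero A] [Zero B] [AddCommMonoid V] (β : A → B → V)
    (hl : ∀ b, β 0 b = 0) (hr : ∀ a, β a 0 = 0) (S : A → A) (U : B → B) (T : V →+ V)
    (h : ∀ a b, T (β a b) = β (S a) b + β a (U b)) :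
    ∀ N m k a b, m + k ≤ N → S^[m] a = 0 → U^[k] b = 0 → T^[N] (β a b) = 0 := by
  intro N
  induction N with
  | zero =>
    intro m k a b hmk ha _
    obtain rfl : m = 0 := by omega
    rw [show a = 0 from ha, hl]
    rfl
  | succ N ih =>
    intro m k a b hmk ha hb
    rcases m with _ | m
    · rw [show a = 0 from ha, hl, iterate_map_zero]
    rcases k with _ | k
    · rw [show b = 0 from hb, hr, iterate_map_zero]
    rw [Function.iterate_succ_apply, h, iterate_map_add,
      ih m (k + 1) _ _ (by omega) ha hb, ih (m + 1) k _ _ (by omega) ha hb, add_zero]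

/-- The subalgebra of polynomials annihilated by a power of `d`. -/
def nil (d : D K n) : Subalgebra K (P K n) where
  carrier := {f | ∃ m, d^[m] f = 0}
  mul_mem' := by
    rintro f g ⟨m, hm⟩ ⟨k, hk⟩
    refine ⟨m + k, iterate_pairing (fun f g => f * g) zero_mul mul_zero d d
      (d : P K n →ₗ[K] P K n).toAddMonoidHom (fun a b => ?_) (m + k) m k f g le_rfl hm hk⟩
    change d (a * b) = d a * b + a * d b
    rw [Derivation.leibniz, smul_eq_mul, smul_eq_mul]
    ring
  add_mem' := by
    rintro f g ⟨m, hm⟩ ⟨k, hk⟩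
    refine ⟨m + k, ?_⟩
    rw [iterate_map_add, add_comm m k, Function.iterate_add_apply, hm, iterate_map_zero,
      add_comm k m, Function.iterate_add_apply, hk, iterate_map_zero, add_zero]
  algebraMap_mem' r := ⟨1, by simp⟩

theorem mem_nil {d : D K n} {f : P K n} : f ∈ nil d ↔ ∃ m, d^[m] f = 0 := Iff.rfl

theorem apply_mem_nil {d y : D K n} (hy : ∃ m, (fun z => ⁅d, z⁆)^[m] y = 0) {f : P K n}
    (hf : f ∈ nil d) : y f ∈ nil d := by
  obtain ⟨m, hm⟩ := hy
  obtain ⟨k, hk⟩ := hf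
  refine ⟨m + k, iterate_pairing (fun (z : D K n) (g : P K n) => z g) (fun b => rfl)
    (fun a => map_zero a) (fun z => ⁅d, z⁆) d (d : P K n →ₗ[K] P K n).toAddMonoidHom
    (fun a b => ?_) (m + k) m k y f le_rfl hm hk⟩
  change d (a b) = ⁅d, a⁆ b + a (d b)
  rw [Derivation.commutator_apply, sub_add_cancel]

theorem divergence_pderiv (i : Fin n) : divergence (pderiv i : D K n) = 0 := by
  classical
  refine Finset.sum_eq_zero fun j _ => ?_
  rw [pderiv_X, Pi.single_apply]
  split_ifs <;> simp

theorem divergence_mul_smul (f : P K n) (d : D K n) :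
    divergence (f • d) = d f + f * divergence d := by
  rw [apply_eq_sum d f, divergence, divergence, Finset.mul_sum, ← Finset.sum_add_distrib]
  refine Finset.sum_congr rfl fun i _ => ?_
  rw [Derivation.smul_apply, smul_eq_mul, pderiv_mul]
  ring

variable (K) in
/-- `∂/∂x_i` as an element of `div_n^c`. -/
def pd (i : Fin n) : divC K n := ⟨pderiv i, 0, by rw [divergence_pderiv, C_0]⟩

variable (K) in
/-- `x_j ∂/∂x_i` as an element of `div_n^c`. -/
def xpd (j i : Fin n) : divC K n :=
  ⟨(X j : P K n) • pderiv i, coeff 0 (pderiv i (X j : P K n)), by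
    classical
    rw [divergence_mul_smul, divergence_pderiv, mul_zero, add_zero, pderiv_X, Pi.single_apply]
    split_ifs <;> simp⟩

/-- A subalgebra of `P_n` stable under `div_n^c` is `K` or `P_n`. -/
theorem X_mem_of_stable [CharZero K] (S : Subalgebra K (P K n))
    (stab : ∀ d ∈ divC K n, ∀ f ∈ S, d f ∈ S) :
    ∀ (N : ℕ) (f : P K n), f ∈ S → (∀ c : K, f ≠ C c) → f.totalDegree ≤ N →
      ∀ j, (X j : P K n) ∈ S := by
  intro N
  induction N with
  | zero =>
    intro f _ hf h0
    exact absurd (totalDegree_eq_zero_iff_eq_C.1 (Nat.le_zero.1 h0)) (hf _)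
  | succ N ih =>
    intro f hS hf hN j
    obtain ⟨k, hk⟩ : ∃ k, pderiv k f ≠ 0 := by
      by_contra! hc
      obtain ⟨c, hc⟩ := eq_C_of_pderiv_eq_zero hc
      exact hf c hc
    -- If `∂_k f` is a nonzero constant, `X_j ∂_k` turns `f` into a multiple of `X_j`; otherwise
    -- `∂_k f` is a nonconstant element of `S` of lower degree.
    by_cases hc : ∃ c : K, pderiv k f = C c
    · obtain ⟨c, hc⟩ := hc
      have h1 : (X j : P K n) * C c ∈ S := by
        have := stab _ (xpd K j k).2 f hS
        rwa [xpd, Derivation.smul_apply, hc] at this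
      have hc0 : c ≠ 0 := fun h => hk (by rw [hc, h, C_0])
      have h2 := S.smul_mem h1 c⁻¹
      rwa [smul_eq_C_mul, mul_left_comm, ← C_mul, inv_mul_cancel₀ hc0, C_1, mul_one] at h2
    · push Not at hc
      exact ih _ (stab _ (pd K k).2 f hS) hc
        ((totalDegree_pderiv_le k f).trans (by omega)) j

theorem eq_top_of_X_mem (S : Subalgebra K (P K n)) (h : ∀ j, (X j : P K n) ∈ S) : S = ⊤ := by
  rw [eq_top_iff, ← MvPolynomial.adjoin_range_X]
  exact Algebra.adjoin_le (by rintro _ ⟨j, rfl⟩; exact h j)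

theorem eq_top_of_stable [CharZero K] (S : Subalgebra K (P K n))
    (stab : ∀ d ∈ divC K n, ∀ f ∈ S, d f ∈ S) {f : P K n} (hS : f ∈ S)
    (hf : ∀ c : K, f ≠ C c) : S = ⊤ :=
  eq_top_of_X_mem S (X_mem_of_stable S stab _ f hS hf le_rfl)

/-! ### Derivatives of determinants -/

theorem derivation_prod {ι R A : Type*} [CommRing R] [CommRing A] [Algebra R A] [DecidableEq ι]
    (d : Derivation R A A) (f : ι → A) (s : Finset ι) :
    d (∏ i ∈ s, f i) = ∑ j ∈ s, ∏ i ∈ s, Function.update f j (d (f j)) i := by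
  induction s using Finset.induction_on with
  | empty => simp
  | insert a s ha ih =>
    rw [Finset.prod_insert ha, Derivation.leibniz, ih, Finset.sum_insert ha,
      Finset.prod_insert ha, Function.update_self, smul_eq_mul, smul_eq_mul, Finset.mul_sum,
      add_comm]
    congr 1
    · rw [mul_comm]
      congr 1
      refine Finset.prod_congr rfl fun i hi => ?_
      rw [Function.update_of_ne (by rintro rfl; exact ha hi)]
    · refine Finset.sum_congr rfl fun j hj => ?_
      rw [Finset.prod_insert ha, Function.update_of_ne (by rintro rfl; exact ha hj)]

theorem derivation_det {ι R A : Type*} [CommRing R] [CommRing A] [Algebra R A] [DecidableEq ι]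
    [Fintype ι] (d : Derivation R A A) (M : Matrix ι ι A) :
    d M.det = ∑ j, (M.updateCol j fun i => d (M i j)).det := by
  simp only [Matrix.det_apply, map_sum]
  rw [Finset.sum_comm]
  refine Finset.sum_congr rfl fun σ _ => ?_
  rw [← Finset.smul_sum, Units.smul_def, Units.smul_def, map_zsmul, derivation_prod]
  congr 1
  refine Finset.sum_congr rfl fun j _ => Finset.prod_congr rfl fun i _ => ?_
  rw [Matrix.updateCol_apply, Function.update_apply]
  split_ifs with h
  · rw [h]
  · rfl

/-- A vector field `d` commuting with the `e i` multiplies their determinant by its divergence. -/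
theorem apply_det_of_commute (d : D K n) (e : Fin n → D K n)
    (comm : ∀ i p, d (e i p) = e i (d p)) :
    d (Matrix.of fun i j => e i (X j : P K n)).det =
      (Matrix.of fun i j => e i (X j : P K n)).det * divergence d := by
  set M : Matrix (Fin n) (Fin n) (P K n) := Matrix.of fun i j => e i (X j) with hM
  rw [derivation_det, divergence, Finset.mul_sum]
  refine Finset.sum_congr rfl fun j _ => ?_
  -- Commutation gives `d M = M J` with `J` the Jacobian matrix of the coefficients of `d`; Cramer's
  -- rule then extracts the diagonal entries of `J`.
  have h1 : (fun i => d (M i j)) = M.mulVec fun k => pderiv k (d (X j)) := by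
    funext i
    rw [hM, Matrix.of_apply, comm, apply_eq_sum (e i)]
    rfl
  rw [h1, ← Matrix.cramer_apply, Matrix.cramer_eq_adjugate_mulVec, Matrix.mulVec_mulVec,
    Matrix.adjugate_mul, Matrix.smul_mulVec, Matrix.one_mulVec]
  rfl

theorem lie_smul_eq (d z : D K n) (f : P K n) : ⁅d, f • z⁆ = d f • z + f • ⁅d, z⁆ := by
  ext j
  simp only [Derivation.commutator_apply, Derivation.smul_apply, Derivation.add_apply,
    Derivation.leibniz, smul_eq_mul]
  ring_nf

theorem lie_sum_smul (d : D K n) (g : Fin n → P K n) (e : Fin n → D K n)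
    (h : ∀ j, ⁅d, e j⁆ = 0) : ⁅d, ∑ j, g j • e j⁆ = ∑ j, d (g j) • e j := by
  have h1 := map_sum (LieAlgebra.ad K (D K n) d) (fun j => g j • e j) Finset.univ
  simp only [LieAlgebra.ad_apply] at h1
  refine h1.trans (Finset.sum_congr rfl fun j _ => ?_)
  rw [lie_smul_eq, h, smul_zero, add_zero]

/-- Differentiating the minimal equation `μ(f) = 0` gives `μ'(f) ∂_i f = 0`, and `μ'(f) ≠ 0` by
minimality and characteristic zero. -/
theorem eq_C_of_isIntegral [CharZero K] {f : P K n} (hf : IsIntegral K f) : ∃ c : K, f = C c := by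
  refine eq_C_of_pderiv_eq_zero fun i => ?_
  have h1 : pderiv i (Polynomial.aeval f (minpoly K f)) = 0 := by rw [minpoly.aeval, map_zero]
  rw [Derivation.map_aeval, smul_eq_mul, mul_eq_zero] at h1
  refine h1.resolve_left fun h2 => ?_
  have h3 := minpoly.natDegree_pos hf
  have hd : Polynomial.derivative (minpoly K f) ≠ 0 := fun h =>
    h3.ne' (Polynomial.derivative_eq_zero.1 h)
  exact absurd (Polynomial.natDegree_derivative_lt h3.ne')
    (not_lt.2 (Polynomial.natDegree_le_natDegree (minpoly.degree_le_of_ne_zero K f hd h2)))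

/-! ### Brackets with the partial derivatives -/

theorem pderiv_X_eq_ite (i j : Fin n) :
    pderiv i (X j : P K n) = if i = j then 1 else 0 := by
  classical
  rw [pderiv_X, Pi.single_apply]
  simp only [eq_comm]

theorem lie_pd_pd (i j : Fin n) : ⁅pd K i, pd K j⁆ = 0 := by
  refine Subtype.ext (derivation_ext fun k => ?_)
  change ⁅(pderiv i : D K n), pderiv j⁆ (X k) = 0
  rw [Derivation.commutator_apply, pderiv_comm, sub_self]

theorem lie_pd_xpd (i k : Fin n) : ⁅pd K i, xpd K i k⁆ = pd K k := by
  refine Subtype.ext ?_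
  change ⁅(pderiv i : D K n), (X i : P K n) • (pderiv k : D K n)⁆ = pderiv k
  have h : ⁅(pderiv i : D K n), pderiv k⁆ = 0 := congrArg Subtype.val (lie_pd_pd i k)
  rw [lie_smul_eq, h, smul_zero, add_zero, pderiv_X_self, one_smul]

theorem coe_sum_smul_pd (c : Fin n → K) :
    ((∑ i, c i • pd K i : divC K n) : D K n) = ∑ i, c i • (pderiv i : D K n) :=
  map_sum (divC K n).toSubmodule.subtype (fun i => c i • pd K i) Finset.univ

theorem sum_smul_pderiv_X (c : Fin n → K) (j : Fin n) :
    (∑ i, c i • (pderiv i : D K n)) (X j) = C (c j) := by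
  rw [sum_apply]
  simp [smul_eq_C_mul, Pi.single_apply]

theorem iterate_lie_pd (i j : Fin n) (z : divC K n) (m : ℕ) :
    ((fun z => ⁅pd K i, z⁆)^[m] z).1 (X j) = (pderiv i)^[m] (z.1 (X j)) := by
  induction m generalizing z with
  | zero => rfl
  | succ m ih =>
    rw [Function.iterate_succ_apply, ih, Function.iterate_succ_apply]
    congr 1
    change ⁅(pderiv i : D K n), z.1⁆ (X j) = _
    rw [Derivation.commutator_apply, pderiv_X_eq_ite]
    split_ifs <;> simp

theorem pd_ad_nilpotent (i : Fin n) (z : divC K n) :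
    ∃ m, (fun z => ⁅pd K i, z⁆)^[m] z = 0 := by
  refine ⟨(∑ j, (z.1 (X j)).totalDegree) + 1, Subtype.ext (derivation_ext fun j => ?_)⟩
  rw [iterate_lie_pd]
  refine pderiv_iterate_totalDegree i _ _ (Nat.lt_succ_of_le ?_)
  exact Finset.single_le_sum (f := fun j => (z.1 (X j)).totalDegree)
    (fun _ _ => Nat.zero_le _) (Finset.mem_univ j)

theorem eq_sum_pd_of_lie_eq_zero [CharZero K] (z : divC K n)
    (h : ∀ i : Fin n, ⁅pd K i, z⁆ = 0) :
    ∃ c : Fin n → K, z = ∑ j, c j • pd K j := by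
  have h1 : ∀ j, ∃ c : K, z.1 (X j) = C c := fun j => by
    refine eq_C_of_pderiv_eq_zero fun i => ?_
    have h2 := iterate_lie_pd i j z 1
    rw [Function.iterate_one, Function.iterate_one, h i] at h2
    exact h2.symm
  choose c hc using h1
  refine ⟨c, Subtype.ext (derivation_ext fun j => ?_)⟩
  rw [coe_sum_smul_pd, sum_smul_pderiv_X, hc]

/-! ### The image of the partial derivatives under an automorphism -/

section Frame

variable (φ : divC K n ≃ₗ⁅K⁆ divC K n)

/-- The image of `∂/∂x_i` under an automorphism of `div_n^c`. -/
def frame (i : Fin n) : D K n := (φ (pd K i)).1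

theorem lie_frame (i : Fin n) (z : divC K n) : ⁅frame φ i, (φ z).1⁆ = (φ ⁅pd K i, z⁆).1 := by
  rw [LieEquiv.map_lie]
  rfl

theorem lie_frame_frame (i j : Fin n) : ⁅frame φ i, frame φ j⁆ = 0 := by
  rw [frame, frame, ← frame, lie_frame, lie_pd_pd, map_zero]
  rfl

theorem frame_comm (i j : Fin n) (p : P K n) :
    frame φ i (frame φ j p) = frame φ j (frame φ i p) := by
  have h := DFunLike.congr_fun (lie_frame_frame φ i j) p
  rw [Derivation.commutator_apply] at h
  exact sub_eq_zero.1 h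

/-- `∂_i = [∂_i, x_i ∂_i]` is a bracket, so its image is a bracket of two fields of constant
divergence. -/
theorem divergence_frame (i : Fin n) : divergence (frame φ i) = 0 := by
  have h := lie_frame φ i (xpd K i i)
  rw [lie_pd_xpd] at h
  obtain ⟨a, ha⟩ := (φ (pd K i)).2
  obtain ⟨b, hb⟩ := (φ (xpd K i i)).2
  rw [frame, ← h, divergence_lie, hb, frame, ha]
  simp

theorem frame_ad_nilpotent (i : Fin n) {y : D K n} (hy : y ∈ divC K n) :
    ∃ m, (fun z => ⁅frame φ i, z⁆)^[m] y = 0 := by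
  have h : ∀ m (z : divC K n), (fun z => ⁅frame φ i, z⁆)^[m] (φ z).1 =
      (φ ((fun z => ⁅pd K i, z⁆)^[m] z)).1 := by
    intro m
    induction m with
    | zero => intro z; rfl
    | succ m ih => intro z; rw [Function.iterate_succ_apply, lie_frame, ih]; rfl
  obtain ⟨m, hm⟩ := pd_ad_nilpotent i (φ.symm ⟨y, hy⟩)
  refine ⟨m, ?_⟩
  have h1 := h m (φ.symm ⟨y, hy⟩)
  rw [hm, φ.apply_symm_apply, map_zero] at h1
  exact h1

theorem frame_apply_mem_nil (i : Fin n) : ∀ y ∈ divC K n, ∀ f ∈ nil (frame φ i),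
    y f ∈ nil (frame φ i) :=
  fun _ hy _ hf => apply_mem_nil (frame_ad_nilpotent φ i hy) hf

theorem coe_map_sum_smul_pd (c : Fin n → K) :
    (φ (∑ j, c j • pd K j)).1 = ∑ j, c j • frame φ j := by
  rw [map_sum]
  refine (map_sum (divC K n).toSubmodule.subtype _ Finset.univ).trans
    (Finset.sum_congr rfl fun j _ => ?_)
  rw [map_smul]
  rfl

theorem eq_sum_frame_of_lie_eq_zero [CharZero K] {y : D K n} (hy : y ∈ divC K n)
    (h : ∀ i, ⁅frame φ i, y⁆ = 0) : ∃ c : Fin n → K, y = ∑ j, c j • frame φ j := by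
  obtain ⟨c, hc⟩ := eq_sum_pd_of_lie_eq_zero (φ.symm ⟨y, hy⟩) fun i => by
    refine φ.injective (Subtype.ext ((lie_frame φ i _).symm.trans ?_))
    rw [φ.apply_symm_apply, map_zero]
    exact h i
  refine ⟨c, ?_⟩
  rw [← coe_map_sum_smul_pd, ← hc, φ.apply_symm_apply]

theorem frame_independent {c : Fin n → K} (h : ∑ j, c j • frame φ j = 0) (j : Fin n) :
    c j = 0 := by
  rw [← coe_map_sum_smul_pd] at h
  have h1 : φ (∑ j, c j • pd K j) = 0 := Subtype.ext h
  rw [map_eq_zero_iff φ φ.injective] at h1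
  have h2 := DFunLike.congr_fun ((coe_sum_smul_pd c).symm.trans (congrArg Subtype.val h1))
    (X j : P K n)
  rw [sum_smul_pderiv_X] at h2
  exact C_injective _ _ (h2.trans C_0.symm)

theorem frame_ne_zero (i : Fin n) : frame φ i ≠ 0 := by
  intro h
  have := frame_independent φ (c := Pi.single i 1)
    (by simp [Pi.single_apply, ite_smul, h]) i
  simp at this

/-- Each `f • frame φ i` lies in `div_n^c` and commutes with the frame, hence lies in its `K`-span.
Stability of this finite-dimensional space under `f` makes `f` integral. -/
theorem eq_C_of_frame_eq_zero [CharZero K] {f : P K n} (h : ∀ i, frame φ i f = 0) :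
    ∃ c : K, f = C c := by
  -- For `n = 0` the span `V` is zero, whereas the integrality criterion needs `V ≠ 0`.
  rcases Nat.eq_zero_or_pos n with rfl | hn
  · exact eq_C_of_pderiv_eq_zero fun i => i.elim0
  let V : Submodule K (D K n) := Submodule.span K (Set.range (frame φ))
  have hmem : ∀ i, f • frame φ i ∈ V := by
    intro i
    obtain ⟨c, hc⟩ := eq_sum_frame_of_lie_eq_zero φ (y := f • frame φ i)
      ⟨0, by rw [divergence_mul_smul, h, divergence_frame, mul_zero, add_zero, C_0]⟩
      (fun j => by rw [lie_smul_eq, h, lie_frame_frame, zero_smul, smul_zero, add_zero])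
    rw [hc]
    exact Submodule.sum_mem _ fun j _ => Submodule.smul_mem _ _ (Submodule.subset_span ⟨j, rfl⟩)
  have tf : Module.IsTorsionFree (P K n) (D K n) := by
    refine .of_smul_eq_zero fun p d h => ?_
    by_cases hp : p = 0
    · exact .inl hp
    · refine .inr (derivation_ext fun j => ?_)
      have hj : p * d (X j) = 0 := DFunLike.congr_fun h (X j)
      exact (mul_eq_zero.1 hj).resolve_left hp
  refine eq_C_of_isIntegral (isIntegral_of_smul_mem_submodule (M := D K n) V ?_ ?_ f ?_)
  · intro hV
    refine frame_ne_zero φ ⟨0, hn⟩ ?_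
    have : frame φ ⟨0, hn⟩ ∈ V := Submodule.subset_span ⟨_, rfl⟩
    rw [hV] at this
    exact this
  · exact Submodule.fg_span (Set.finite_range _)
  · intro v hv
    induction hv using Submodule.span_induction with
    | mem x hx => obtain ⟨i, rfl⟩ := hx; exact hmem i
    | zero => rw [smul_zero]; exact V.zero_mem
    | add x y _ _ hx hy => rw [smul_add]; exact V.add_mem hx hy
    | smul c x _ hx => rw [smul_comm]; exact V.smul_mem c hx

end Frame

/-! ### Independence of the frame over `P_n` -/

/-- The vector field `∂_l(g) ∂_k - ∂_k(g) ∂_l`. -/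
def rot (k l : Fin n) (g : P K n) : D K n :=
  pderiv l g • (pderiv k : D K n) - pderiv k g • (pderiv l : D K n)

theorem rot_apply (k l : Fin n) (g p : P K n) :
    rot k l g p = pderiv l g * pderiv k p - pderiv k g * pderiv l p := rfl

theorem rot_mem (k l : Fin n) (g : P K n) : rot k l g ∈ divC K n := by
  refine ⟨0, ?_⟩
  have h : ∀ d e : D K n, divergence (d - e) = divergence d - divergence e := fun d e => by
    rw [eq_sub_iff_add_eq, ← divergence_add, sub_add_cancel]
  rw [rot, h, divergence_mul_smul, divergence_mul_smul, divergence_pderiv, divergence_pderiv,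
    pderiv_comm k l]
  simp

/-- If `d (a / b) = 0`, `d` is nilpotent on `y` and `y (a / b)` is a polynomial `Q`, then `d` is
nilpotent on `Q`. -/
theorem mem_nil_of_wronskian (d y : D K n) {a b Q : P K n} (hb : b ≠ 0)
    (hy : ∃ m, (fun z => ⁅d, z⁆)^[m] y = 0) (hab : b * d a = a * d b)
    (hQ : b * y a - a * y b = b ^ 2 * Q) : Q ∈ nil d := by
  obtain ⟨m, hm⟩ := hy
  refine ⟨m, ?_⟩
  induction m generalizing y Q with
  | zero =>
    rw [show y = 0 from hm] at hQ
    simp only [Derivation.zero_apply, mul_zero, sub_zero] at hQ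
    exact (mul_eq_zero.1 hQ.symm).resolve_left (pow_ne_zero 2 hb)
  | succ m ih =>
    rw [Function.iterate_succ_apply] at hm ⊢
    refine ih ⁅d, y⁆ ?_ hm
    have h1 := congrArg d hQ
    have h2 := congrArg y hab
    simp only [map_sub, Derivation.leibniz, smul_eq_mul, pow_two] at h1 h2
    rw [Derivation.commutator_apply, Derivation.commutator_apply]
    refine mul_left_cancel₀ hb ?_
    linear_combination b * h1 - b * h2 - 2 * d b * hQ + 2 * y b * hab

section Rank

variable [CharZero K] (φ : divC K n ≃ₗ⁅K⁆ divC K n)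

/-- If a nonconstant quotient `a / b` is annihilated by all `frame φ i`, these are locally
nilpotent. -/
theorem nil_frame_eq_top_of_wronskian {a b : P K n} (hb : b ≠ 0)
    (hab : ∀ i, b * frame φ i a = a * frame φ i b) {k l : Fin n} (hkl : l ≠ k)
    (hθ : b * pderiv k a - a * pderiv k b ≠ 0) (i : Fin n) : nil (frame φ i) = ⊤ := by
  set θ := b * pderiv k a - a * pderiv k b with hθdef
  -- `X_l R m` is the value of `rot k l (b² X_l^(m+2))` on `a / b`; the factor `b²` clears the
  -- denominator. The brackets for `m = 0, 1` differ by `θ ≠ 0`, so one `R m` is nonzero, and the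
  -- extra `X_l` makes the product nonconstant.
  let R : ℕ → P K n := fun m =>
    (X l) ^ m * ((m + 2 : P K n) * θ + 2 * X l * rot k l b a)
  obtain ⟨m, hm⟩ : ∃ m, R m ≠ 0 := by
    by_contra! hR
    have h0 := hR 0
    have h1 := hR 1
    have hX : (X l : P K n) ≠ 0 := X_ne_zero l
    simp only [R, mul_eq_zero, pow_eq_zero_iff', hX, false_and, false_or] at h0 h1
    refine hθ ?_
    push_cast at h0 h1
    linear_combination h1 - h0
  have hQ : X l * R m ∈ nil (frame φ i) := by
    refine mem_nil_of_wronskian (frame φ i) (rot k l (b ^ 2 * X l ^ (m + 2))) hb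
      (frame_ad_nilpotent φ i (rot_mem k l _)) (hab i) ?_
    have h1 : pderiv k (X l : P K n) = 0 := pderiv_X_of_ne hkl
    simp only [R, hθdef, rot_apply, pderiv_mul, pderiv_pow, pderiv_X_self, h1,
      Nat.cast_add, Nat.cast_ofNat, show m + 2 - 1 = m + 1 from rfl]
    ring
  refine eq_top_of_stable _ (frame_apply_mem_nil φ i) hQ fun c hc => hm ?_
  have h1 := congrArg (eval fun _ => (0 : K)) hc
  rw [map_mul, eval_X, zero_mul, eval_C] at h1
  rw [← h1, C_0] at hc
  exact (mul_eq_zero.1 hc).resolve_left (X_ne_zero l)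

/-- Either the partial derivatives kill `a / b`, or the frame is locally nilpotent; in both cases a
commuting locally nilpotent family with common kernel `K` kills `a / b`. -/
theorem ratio_const_of_frame {a b : P K n} (hb : b ≠ 0)
    (hab : ∀ i, b * frame φ i a = a * frame φ i b) (hn : Nontrivial (Fin n)) :
    ∃ c : K, a = C c * b := by
  by_cases h : ∀ k, b * pderiv k a = a * pderiv k b
  · exact eq_C_mul_of_wronskian_eq_zero (fun i => pderiv i) pderiv_comm
      pderiv_locally_nilpotent (fun p => eq_C_of_pderiv_eq_zero) hb h
  · push Not at h
    obtain ⟨k, hk⟩ := h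
    obtain ⟨l, hl⟩ := exists_ne k
    refine eq_C_mul_of_wronskian_eq_zero (frame φ) (frame_comm φ) (fun i p => ?_)
      (fun p => eq_C_of_frame_eq_zero φ) hb hab
    have := nil_frame_eq_top_of_wronskian φ hb hab hl (sub_ne_zero.2 hk) i
    exact mem_nil.1 (this ▸ Algebra.mem_top)

open Classical in
theorem frame_linearIndependent_aux : ∀ (N : ℕ) (c : Fin n → P K n),
    (Finset.univ.filter fun j => c j ≠ 0).card ≤ N → ∑ j, c j • frame φ j = 0 → c = 0 := by
  intro N
  induction N with
  | zero =>
    intro c hc _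
    rw [Nat.le_zero, Finset.card_eq_zero, Finset.filter_eq_empty_iff] at hc
    exact funext fun j => not_not.1 (hc (Finset.mem_univ j))
  | succ N ih =>
    intro c hc h
    by_contra hne
    obtain ⟨s, hs⟩ := Function.ne_iff.1 hne
    have hW : ∀ i j, c s * frame φ i (c j) = c j * frame φ i (c s) := by
      intro i j
      have h1 : ∑ j, frame φ i (c j) • frame φ j = 0 := by
        rw [← lie_sum_smul _ _ _ (lie_frame_frame φ i), h]
        exact map_zero (LieAlgebra.ad K (D K n) (frame φ i))
      -- Combining the relation with its bracket by `frame φ i` cancels coefficient `s`, leaving a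
      -- shorter relation.
      have h2 := ih (fun j => c s * frame φ i (c j) - frame φ i (c s) * c j) ?_ ?_
      · rw [mul_comm (c j)]
        exact sub_eq_zero.1 (congrFun h2 j)
      · refine Nat.le_of_lt_succ (lt_of_lt_of_le (Finset.card_lt_card ?_) hc)
        refine Finset.ssubset_iff_subset_ne.2 ⟨fun j hj => ?_, fun he => ?_⟩
        · rw [Finset.mem_filter] at hj ⊢
          refine ⟨hj.1, fun h0 => hj.2 ?_⟩
          rw [h0, map_zero, mul_zero, mul_zero, sub_zero]
        · have : s ∈ Finset.univ.filter fun j => c j ≠ 0 := by simpa using hs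
          rw [← he, Finset.mem_filter] at this
          exact this.2 (by ring)
      · refine derivation_ext fun k => ?_
        have h1k := DFunLike.congr_fun h1 (X k)
        have hk := DFunLike.congr_fun h (X k)
        simp only [sum_apply, Derivation.smul_apply, smul_eq_mul, Derivation.zero_apply]
          at h1k hk ⊢
        simp only [sub_mul, mul_assoc, Finset.sum_sub_distrib, ← Finset.mul_sum]
        rw [h1k, hk, mul_zero, mul_zero, sub_zero]
    have hr : ∀ j, ∃ κ : K, c j = C κ * c s := by
      intro j
      by_cases hj : j = s
      · exact ⟨1, by rw [hj, C_1, one_mul]⟩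
      · exact ratio_const_of_frame φ hs (fun i => hW i j) ⟨j, s, hj⟩
    choose κ hκ using hr
    have h3 : c s • ∑ j, κ j • frame φ j = 0 := by
      rw [← h, Finset.smul_sum]
      refine Finset.sum_congr rfl fun j _ => ?_
      rw [hκ j, mul_comm, mul_smul, ← algebraMap_smul (P K n) (κ j)]
      rfl
    have h4 : ∑ j, κ j • frame φ j = 0 := by
      refine derivation_ext fun j => ?_
      have hj : c s * (∑ j, κ j • frame φ j) (X j) = 0 := DFunLike.congr_fun h3 (X j)
      exact (mul_eq_zero.1 hj).resolve_left hs
    apply hs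
    rw [hκ s, frame_independent φ h4 s, C_0, zero_mul]
    rfl

theorem frame_linearIndependent {c : Fin n → P K n} (h : ∑ j, c j • frame φ j = 0) : c = 0 :=
  frame_linearIndependent_aux φ _ c le_rfl h

/-- The coefficient determinant is nonzero by independence and constant because the divergence-free
frame kills it, so the adjugate inverts the matrix over `P_n`. -/
theorem exists_eq_sum_frame (d : D K n) : ∃ g : Fin n → P K n, d = ∑ j, g j • frame φ j := by
  classical
  set M : Matrix (Fin n) (Fin n) (P K n) := Matrix.of fun i j => frame φ i (X j) with hM
  have hsum : ∀ (g : Fin n → P K n) j, (∑ j, g j • frame φ j) (X j) = Matrix.vecMul g M j := by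
    intro g j
    rw [sum_apply]
    rfl
  have hdet : M.det ≠ 0 := by
    intro h
    obtain ⟨v, hv0, hv⟩ := Matrix.exists_vecMul_eq_zero_iff.2 h
    refine hv0 (frame_linearIndependent φ (derivation_ext fun j => ?_))
    rw [hsum, hv]
    rfl
  obtain ⟨c, hc⟩ := eq_C_of_frame_eq_zero φ (f := M.det) fun i => by
    rw [hM, apply_det_of_commute _ _ fun j => frame_comm φ i j, divergence_frame, mul_zero]
  have hc0 : c ≠ 0 := fun h => hdet (by rw [hc, h, C_0])
  refine ⟨Matrix.vecMul (fun j => C c⁻¹ * d (X j)) M.adjugate, derivation_ext fun j => ?_⟩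
  rw [hsum, Matrix.vecMul_vecMul, Matrix.adjugate_mul, hc, Matrix.vecMul_smul,
    Matrix.vecMul_one, Pi.smul_apply, smul_eq_mul, ← mul_assoc, ← C_mul, mul_inv_cancel₀ hc0,
    C_1, one_mul]

end Rank

/-! ### The Euler field and dual coordinates -/

theorem derivation_aeval (d : D K n) (x : Fin n → P K n) (p : P K n) :
    d (aeval x p) = ∑ k, aeval x (pderiv k p) * d (x k) := by
  classical
  induction p using MvPolynomial.induction_on with
  | C a => simp
  | add p q hp hq => simp only [map_add, hp, hq, add_mul, Finset.sum_add_distrib]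
  | mul_X p i hp =>
    simp only [map_mul, aeval_X, Derivation.leibniz, smul_eq_mul, hp, pderiv_X_eq_ite, map_add,
      add_mul, Finset.sum_add_distrib]
    simp [Finset.mul_sum, mul_assoc]

variable (K n) in
/-- The Euler vector field `∑ x_i ∂/∂x_i`. -/
def euler : divC K n := ∑ i, xpd K i i

theorem euler_apply (p : P K n) : (euler K n).1 p = ∑ i, X i * pderiv i p := by
  have h : (euler K n).1 = ∑ i, (X i : P K n) • (pderiv i : D K n) :=
    map_sum (divC K n).toSubmodule.subtype (fun i => xpd K i i) Finset.univ
  rw [h, sum_apply]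
  rfl

theorem euler_X (j : Fin n) : (euler K n).1 (X j) = X j := by
  simp [euler_apply, Pi.single_apply]

theorem lie_pd_euler (i : Fin n) : ⁅pd K i, euler K n⁆ = pd K i := by
  refine Subtype.ext (derivation_ext fun j => ?_)
  change ⁅(pderiv i : D K n), (euler K n).1⁆ (X j) = pderiv i (X j)
  rw [Derivation.commutator_apply, euler_X, pderiv_X_eq_ite]
  split_ifs <;> simp

theorem coeff_euler (m : Fin n →₀ ℕ) (p : P K n) :
    coeff m ((euler K n).1 p) = (m.sum fun _ e => e : ℕ) * coeff m p := by
  classical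
  rw [euler_apply, coeff_sum, Finsupp.sum_fintype _ _ fun _ => rfl, Nat.cast_sum, Finset.sum_mul]
  refine Finset.sum_congr rfl fun i _ => ?_
  rw [mul_comm, coeff_mul_X']
  split_ifs with hi
  · have hi' := Finsupp.mem_support_iff.1 hi
    rw [coeff_pderiv, tsub_add_cancel_of_le (Finsupp.single_le_iff.2
      (Nat.one_le_iff_ne_zero.2 hi')), mul_comm]
    congr 1
    rw [Finsupp.tsub_apply, Finsupp.single_eq_same, ← Nat.cast_add_one,
      Nat.sub_add_cancel (Nat.one_le_iff_ne_zero.2 hi')]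
  · rw [Finsupp.notMem_support_iff.1 hi, Nat.cast_zero, zero_mul]

/-- The Euler field multiplies the component of degree `d` by `d`, so `N + 1 - E` kills the top one.
-/
theorem totalDegree_sub_euler_le {N : ℕ} {p : P K n} (hp : p.totalDegree ≤ N + 1) :
    (((N + 1 : ℕ) : K) • p - (euler K n).1 p).totalDegree ≤ N := by
  classical
  refine Finset.sup_le fun m hm => ?_
  rw [mem_support_iff, coeff_sub, coeff_smul, coeff_euler, smul_eq_mul, ← sub_mul] at hm
  have h1 := le_totalDegree (mem_support_iff.2 (right_ne_zero_of_mul hm))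
  have h2 : (m.sum fun _ e => e) ≠ N + 1 := fun h => left_ne_zero_of_mul hm (by rw [h, sub_self])
  omega

theorem frame_aeval {φ : divC K n ≃ₗ⁅K⁆ divC K n} {x : Fin n → P K n}
    (hd : ∀ k j, frame φ k (x j) = if k = j then 1 else 0) (k : Fin n) (p : P K n) :
    frame φ k (aeval x p) = aeval x (pderiv k p) := by
  rw [derivation_aeval]
  simp [hd]

theorem map_euler_aeval {φ : divC K n ≃ₗ⁅K⁆ divC K n} {x : Fin n → P K n}
    (hx : (φ (euler K n)).1 = ∑ j, x j • frame φ j)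
    (hd : ∀ k j, frame φ k (x j) = if k = j then 1 else 0) (p : P K n) :
    (φ (euler K n)).1 (aeval x p) = aeval x ((euler K n).1 p) := by
  rw [hx, sum_apply, euler_apply, map_sum]
  refine Finset.sum_congr rfl fun j _ => ?_
  rw [Derivation.smul_apply, frame_aeval hd, smul_eq_mul, map_mul, aeval_X]

section Automorphism

variable [CharZero K] (φ : divC K n ≃ₗ⁅K⁆ divC K n)

theorem exists_dual_coordinates : ∃ x : Fin n → P K n,
    (φ (euler K n)).1 = ∑ j, x j • frame φ j ∧
      ∀ k j, frame φ k (x j) = if k = j then 1 else 0 := by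
  obtain ⟨x, hx⟩ := exists_eq_sum_frame φ (φ (euler K n)).1
  refine ⟨x, hx, fun k j => ?_⟩
  have h1 := lie_frame φ k (euler K n)
  rw [lie_pd_euler, hx, lie_sum_smul _ _ _ (lie_frame_frame φ k)] at h1
  have h2 : ∑ j, (frame φ k (x j) - if k = j then 1 else 0) • frame φ j = 0 := by
    refine derivation_ext fun i => ?_
    have h3 := DFunLike.congr_fun h1 (X i)
    simp only [sum_apply, Derivation.smul_apply, smul_eq_mul, Derivation.zero_apply] at h3 ⊢
    simp only [sub_mul, Finset.sum_sub_distrib, h3]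
    simp [frame]
  exact sub_eq_zero.1 (congrFun (frame_linearIndependent φ h2) j)

variable {φ} {x : Fin n → P K n} (hx : (φ (euler K n)).1 = ∑ j, x j • frame φ j)
  (hd : ∀ k j, frame φ k (x j) = if k = j then 1 else 0)

include hx hd in
theorem map_apply_dual_coordinate : ∀ (N : ℕ) (z : divC K n),
    (∀ j, (z.1 (X j)).totalDegree ≤ N) → ∀ j, (φ z).1 (x j) = aeval x (z.1 (X j)) := by
  intro N
  induction N with
  | zero =>
    intro z hz j
    have hc := fun j => totalDegree_eq_zero_iff_eq_C.1 (Nat.le_zero.1 (hz j))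
    have hz' : z = ∑ j, coeff 0 (z.1 (X j)) • pd K j := by
      refine Subtype.ext (derivation_ext fun j => ?_)
      rw [coe_sum_smul_pd, sum_smul_pderiv_X]
      exact hc j
    have h1 : (φ z).1 = ∑ j, coeff 0 (z.1 (X j)) • frame φ j := by
      conv_lhs => rw [hz']
      rw [coe_map_sum_smul_pd]
    rw [h1, sum_apply, hc j, aeval_C]
    simp [hd, Algebra.smul_def]
  | succ N ih =>
    intro z hz
    -- Bracketing with `∂_i` lowers degrees, so by induction the frame kills the discrepancy, which
    -- is therefore an unknown constant.
    have h1 : ∀ j, ∃ c : K, (φ z).1 (x j) - aeval x (z.1 (X j)) = C c := by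
      intro j
      refine eq_C_of_frame_eq_zero φ fun i => ?_
      have h2 := ih ⁅pd K i, z⁆ (fun j => ?_) j
      · rw [← lie_frame, Derivation.commutator_apply, hd] at h2
        have h3 := iterate_lie_pd i j z 1
        rw [Function.iterate_one, Function.iterate_one] at h3
        rw [h3] at h2
        rw [map_sub, frame_aeval hd, ← h2]
        split_ifs <;> simp
      · have h3 := iterate_lie_pd i j z 1
        rw [Function.iterate_one, Function.iterate_one] at h3
        rw [h3]
        exact (totalDegree_pderiv_le i _).trans (by have := hz j; omega)
    -- This field has coefficients `E(z X_j)`, and applying `φ(E)` to the discrepancy removes the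
    -- unknown constant. Subtracting it from `(N + 1) z` drops the degree, so induction determines
    -- `(N + 1) φ(z)(x_j)`.
    have hT : ∀ j, (⁅euler K n, z⁆ + z).1 (X j) = (euler K n).1 (z.1 (X j)) := by
      intro j
      change ⁅(euler K n).1, z.1⁆ (X j) + z.1 (X j) = _
      rw [Derivation.commutator_apply, euler_X, sub_add_cancel]
    have hφT : ∀ j, (φ (⁅euler K n, z⁆ + z)).1 (x j) = aeval x ((euler K n).1 (z.1 (X j))) := by
      intro j
      obtain ⟨c, hc⟩ := h1 j
      rw [map_add, LieEquiv.map_lie]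
      change ⁅(φ (euler K n)).1, (φ z).1⁆ (x j) + (φ z).1 (x j) = _
      have hE : (φ (euler K n)).1 (x j) = x j := by
        have := map_euler_aeval hx hd (X j)
        rwa [euler_X, aeval_X] at this
      rw [Derivation.commutator_apply, hE, sub_add_cancel, sub_eq_iff_eq_add.1 hc, map_add,
        map_euler_aeval hx hd]
      simp
    intro j
    have hdeg := ih (((N + 1 : ℕ) : K) • z - (⁅euler K n, z⁆ + z)) (fun j => ?_) j
    · have h2 : (((N + 1 : ℕ) : K) • z - (⁅euler K n, z⁆ + z)).1 (X j) =
          ((N + 1 : ℕ) : K) • z.1 (X j) - (euler K n).1 (z.1 (X j)) := by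
        rw [← hT]
        rfl
      have h3 : (φ (((N + 1 : ℕ) : K) • z - (⁅euler K n, z⁆ + z))).1 (x j) =
          ((N + 1 : ℕ) : K) • (φ z).1 (x j) - (φ (⁅euler K n, z⁆ + z)).1 (x j) := by
        rw [map_sub, map_smul]
        rfl
      rw [h3, h2, hφT, map_sub, map_smul, sub_left_inj] at hdeg
      exact smul_right_injective _ (Nat.cast_ne_zero.2 N.succ_ne_zero) hdeg
    · have h2 := totalDegree_sub_euler_le (hz j)
      rwa [← hT] at h2

include hx hd in
theorem map_apply_aeval (z : divC K n) (p : P K n) :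
    (φ z).1 (aeval x p) = aeval x (z.1 p) := by
  rw [derivation_aeval, apply_eq_sum z.1, map_sum]
  refine Finset.sum_congr rfl fun j _ => ?_
  rw [map_apply_dual_coordinate hx hd _ z fun j =>
    Finset.le_sup (f := fun j => (z.1 (X j)).totalDegree) (Finset.mem_univ j), map_mul, mul_comm]

include hd in
theorem aeval_injective : Function.Injective (aeval x : P K n →ₐ[K] P K n) := by
  rw [injective_iff_map_eq_zero]
  intro p hp
  by_contra hp0
  obtain ⟨w, hw, hw0, hw'⟩ := exists_common_kernel
    (fun i => ((pderiv i : D K n) : P K n →ₗ[K] P K n)) pderiv_comm pderiv_locally_nilpotent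
    (LinearMap.ker (aeval x : P K n →ₐ[K] P K n).toLinearMap)
    (fun i v hv => by
      change aeval x (pderiv i v) = 0
      rw [← frame_aeval hd, show aeval x v = 0 from hv, map_zero])
    (v := p) hp hp0 Finset.univ
  obtain ⟨c, rfl⟩ := eq_C_of_pderiv_eq_zero fun i => hw' i (Finset.mem_univ i)
  have h1 : C c = (0 : P K n) := by
    rw [← show aeval x (C c) = (0 : P K n) from hw, aeval_C]
    rfl
  exact hw0 h1

include hx hd in
theorem aeval_surjective : Function.Surjective (aeval x : P K n →ₐ[K] P K n) := by
  rw [← AlgHom.range_eq_top]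
  refine eq_top_of_X_mem _ fun j => ?_
  have h1 : (aeval x : P K n →ₐ[K] P K n).range = ⊤ := by
    refine eq_top_of_stable _ ?_ (f := x j) ⟨X j, aeval_X _ _⟩ fun c hc => ?_
    · rintro d hd' _ ⟨p, rfl⟩
      refine ⟨(φ.symm ⟨d, hd'⟩).1 p, ?_⟩
      have h2 := map_apply_aeval hx hd (φ.symm ⟨d, hd'⟩) p
      rw [φ.apply_symm_apply] at h2
      exact h2.symm
    · have h2 := hd j j
      rw [hc, if_pos rfl] at h2
      simp at h2
  rw [h1]
  exact Algebra.mem_top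

variable (φ) in
/-- Every automorphism of `div_n^c` is a conjugation by a polynomial automorphism. -/
theorem exists_algEquiv : ∃ σ : P K n ≃ₐ[K] P K n, ∀ z p, (φ z).1 p = σ (z.1 (σ.symm p)) := by
  obtain ⟨x, hx, hd⟩ := exists_dual_coordinates φ
  refine ⟨AlgEquiv.ofBijective (aeval x) ⟨aeval_injective hd, aeval_surjective hx hd⟩, ?_⟩
  intro z p
  set σ := AlgEquiv.ofBijective (aeval x) ⟨aeval_injective hd, aeval_surjective hx hd⟩
  have h := map_apply_aeval hx hd z (σ.symm p)
  have h1 : aeval x (σ.symm p) = p := σ.apply_symm_apply p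
  rwa [h1] at h

end Automorphism

/-! ### Conjugation by polynomial automorphisms -/

/-- The conjugate `σ ∂ σ⁻¹` of a vector field. -/
def conj (σ : P K n ≃ₐ[K] P K n) (d : D K n) : D K n :=
  Derivation.mk' (σ.toLinearMap ∘ₗ (d : P K n →ₗ[K] P K n) ∘ₗ σ.symm.toLinearMap) fun a b => by
    change σ (d (σ.symm (a * b))) = a • σ (d (σ.symm b)) + b • σ (d (σ.symm a))
    simp

theorem conj_apply (σ : P K n ≃ₐ[K] P K n) (d : D K n) (p : P K n) :
    conj σ d p = σ (d (σ.symm p)) := rfl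

theorem conj_eq_sum (σ : P K n ≃ₐ[K] P K n) (d : D K n) :
    conj σ d = ∑ i, σ (d (X i)) • conj σ (pderiv i) := by
  refine derivation_ext fun j => ?_
  rw [sum_apply, conj_apply, apply_eq_sum d, map_sum]
  refine Finset.sum_congr rfl fun i _ => ?_
  rw [map_mul]
  rfl

theorem divergence_conj_pderiv (σ : P K n ≃ₐ[K] P K n) (i : Fin n) :
    divergence (conj σ (pderiv i)) = 0 := by
  classical
  set M : Matrix (Fin n) (Fin n) (P K n) :=
    Matrix.of fun i j => conj σ (pderiv i) (X j) with hM
  -- Expanding `∂_k` in the fields `σ ∂_i σ⁻¹` shows that the Jacobian matrix of `σ` inverts `M`.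
  have h1 : (Matrix.of fun k l => pderiv k (σ (X l))) * M = 1 := by
    refine Matrix.ext fun k j => ?_
    have h2 : conj σ (conj σ.symm (pderiv k)) (X j) = pderiv k (X j) := by simp [conj_apply]
    rw [conj_eq_sum, sum_apply] at h2
    rw [Matrix.one_apply, ← pderiv_X_eq_ite, ← h2, Matrix.mul_apply]
    refine Finset.sum_congr rfl fun i _ => ?_
    simp [hM, conj_apply]
  have hu : IsUnit M.det := by
    rw [← Matrix.isUnit_iff_isUnit_det]
    exact .of_mul_eq_one _ (mul_eq_one_comm.1 h1)
  have h3 := apply_det_of_commute (conj σ (pderiv i)) (fun i => conj σ (pderiv i)) fun j p => by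
    simp [conj_apply, pderiv_comm i j]
  obtain ⟨c, -, hc⟩ := MvPolynomial.isUnit_iff_eq_C_of_isReduced.1 hu
  rw [← hM, hc, show conj σ (pderiv i) (C c) = 0 from Derivation.map_algebraMap _ c, ← hc] at h3
  exact (mul_eq_zero.1 h3.symm).resolve_left hu.ne_zero

theorem divergence_sum (f : Fin n → D K n) : divergence (∑ i, f i) = ∑ i, divergence (f i) :=
  map_sum (⟨⟨divergence, divergence_zero⟩, divergence_add⟩ : D K n →+ P K n) f Finset.univ

theorem divergence_conj (σ : P K n ≃ₐ[K] P K n) (d : D K n) :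
    divergence (conj σ d) = σ (divergence d) := by
  rw [conj_eq_sum, divergence_sum, divergence, map_sum]
  refine Finset.sum_congr rfl fun i _ => ?_
  rw [divergence_mul_smul, divergence_conj_pderiv, mul_zero, add_zero, conj_apply,
    σ.symm_apply_apply]

theorem conj_mem (σ : P K n ≃ₐ[K] P K n) {d : D K n} (hd : d ∈ divC K n) :
    conj σ d ∈ divC K n := by
  obtain ⟨c, hc⟩ := hd
  exact ⟨c, by rw [divergence_conj, hc]; exact σ.commutes c⟩

/-- Conjugation by a polynomial automorphism as an automorphism of `div_n^c`. -/
def conjLieEquiv (σ : P K n ≃ₐ[K] P K n) : divC K n ≃ₗ⁅K⁆ divC K n where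
  toFun d := ⟨conj σ d.1, conj_mem σ d.2⟩
  map_add' d e := Subtype.ext (derivation_ext fun j => map_add σ _ _)
  map_smul' c d := Subtype.ext (derivation_ext fun j => map_smul σ c _)
  map_lie' {d e} := by
    refine Subtype.ext (derivation_ext fun j => ?_)
    change conj σ ⁅d.1, e.1⁆ (X j) = ⁅conj σ d.1, conj σ e.1⁆ (X j)
    simp [Derivation.commutator_apply, conj_apply]
  invFun d := ⟨conj σ.symm d.1, conj_mem σ.symm d.2⟩
  left_inv d := Subtype.ext (derivation_ext fun j => by simp [conj_apply])
  right_inv d := Subtype.ext (derivation_ext fun j => by simp [conj_apply])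

variable (K n) in
/-- The action of the group of polynomial automorphisms on `div_n^c`. -/
def conjHom : (P K n ≃ₐ[K] P K n) →* (divC K n ≃ₗ⁅K⁆ divC K n) where
  toFun := conjLieEquiv
  map_one' := rfl
  map_mul' _ _ := rfl

theorem conjHom_apply (σ : P K n ≃ₐ[K] P K n) (d : divC K n) (p : P K n) :
    (conjHom K n σ d).1 p = σ (d.1 (σ.symm p)) := rfl

/-- Commuting with every `∂_i` forces `σ` to be a translation, and commuting with the Euler field
makes the translation zero. -/
theorem conjHom_injective [CharZero K] : Function.Injective (conjHom K n) := by
  rw [injective_iff_map_eq_one]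
  intro σ hσ
  have h : ∀ (d : divC K n) p, σ (d.1 p) = d.1 (σ p) := by
    intro d p
    have h1 := conjHom_apply σ d (σ p)
    rw [hσ, σ.symm_apply_apply] at h1
    exact h1.symm
  have hX : ∀ j, σ (X j) = X j := by
    intro j
    obtain ⟨c, hc⟩ := eq_C_of_pderiv_eq_zero (p := σ (X j) - X j) fun i => by
      have h1 : σ (pderiv i (X j)) = pderiv i (σ (X j)) := h (pd K i) (X j)
      rw [map_sub, ← h1, pderiv_X_eq_ite]
      split_ifs <;> simp
    have h2 := h (euler K n) (X j)
    have h3 : (euler K n).1 (C c) = 0 := Derivation.map_algebraMap _ c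
    rw [← hc, map_sub, euler_X, ← h2, euler_X] at h3
    exact sub_eq_zero.1 h3
  refine AlgEquiv.ext fun p => ?_
  have h1 : (σ : P K n →ₐ[K] P K n) = AlgHom.id K _ := algHom_ext fun j => hX j
  exact DFunLike.congr_fun h1 p

theorem conjHom_surjective [CharZero K] : Function.Surjective (conjHom K n) := by
  intro φ
  obtain ⟨σ, hσ⟩ := exists_algEquiv φ
  exact ⟨σ, LieEquiv.ext fun z => Subtype.ext (Derivation.ext fun p => (hσ z p).symm)⟩

end PolyVectorField

end

theorem theorem1p2 (K : Type*) [Field K] [CharZero K] (n : ℕ) :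
    ∃ Φ : (MvPolynomial (Fin n) K ≃ₐ[K] MvPolynomial (Fin n) K) ≃*
        (PolyVectorField.divC K n ≃ₗ⁅K⁆ PolyVectorField.divC K n),
      ∀ (σ : MvPolynomial (Fin n) K ≃ₐ[K] MvPolynomial (Fin n) K)
        (d : PolyVectorField.divC K n) (p : MvPolynomial (Fin n) K),
        (Φ σ d).1 p = σ (d.1 (σ.symm p)) :=
  ⟨MulEquiv.ofBijective (PolyVectorField.conjHom K n)
    ⟨PolyVectorField.conjHom_injective, PolyVectorField.conjHom_surjective⟩, fun _ _ _ => rfl⟩
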